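/- Let $K$ be a field, let $T$ be a tree with vertex set $\{1,\dots,n\}$, let $u\neq v$ be two pendant (degree one) vertices of $T$ that are not adjacent in $T$, and let $G$ be the unicyclic graph obtained from $T$ by adding the edge $e=\{u,v\}$. For an edge $\{i,j\}$ with $i<j$ put $f_{\{i,j\}}=x_iy_j-x_jy_i\in S=K[x_1,\dots,x_n,y_1,\dots,y_n]$. A sequence $z_1,\dots,z_m$ in a commutative ring is a *$p$-sequence* if it is a minimal system of generators of the ideal $(z_1,\dots,z_m)$ (no $z_j$ lies in the ideal generated by the others) and $$(z_1,\dots,z_i):z_{i_1}z_{i_2}=(z_1,\dots,z_i):z_{i_1}\qquad\text{for all } 0\le i\le m-1,\ i<i_1\le i_2\le m,$$ where for $i=0$ the ideal is $(0)$. Then: 1. The edge binomials $f_{e'}$, $e'\in E(G)$, can be arranged in a $p$-sequence (each edge occurring exactly once). 2. More precisely, let $T$ be rooted at a pendant vertex $x_0$ and drawn in the plane, so that $E(T)$ is listed level by level and from left to right inside each level: $e_{1,1},e_{2,1},\dots,e_{2,k_2},\dots,e_{m,1},\dots,e_{m,k_m}$. Here the level of an edge is the distance from $x_0$ to its endpoint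 farther from $x_0$, $m$ is the maximal level, and left to right means that, for two edges of the same level $\ge 2$ in this order, the edges of the previous level to which they are attached are equal or are also in this order. If an endpoint of $e$ lies on the last edge $e_{m,k_m}$ (that is, $u$ or $v$ is the last vertex of the last level), then the edge binomials in the order $$e_{1,1},\,e_{2,1},\dots,e_{2,k_2},\dots,e_{m,1},\dots,e_{m,k_m},\,e$$ form a $p$-sequence. -/

import Mathlib

/-- The binomial `f_e = x_i y_j - x_j y_i` of an edge `e = {i, j}`, `i < j`, in the polynomial ring
`K[x_1, …, x_n, y_1, …, y_n]`; the variables `x_i` are indexed by `Sum.inl i` and the variables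
`y_i` by `Sum.inr i`. -/
noncomputable def edgeBinomial (K : Type*) [Field K] {n : ℕ} (e : Sym2 (Fin n)) :
    MvPolynomial (Fin n ⊕ Fin n) K :=
  MvPolynomial.X (Sum.inl e.inf) * MvPolynomial.X (Sum.inr e.sup) -
    MvPolynomial.X (Sum.inl e.sup) * MvPolynomial.X (Sum.inr e.inf)

/-- `z` is a `p`-sequence: no member lies in the ideal generated by the other members, and
`(z_1, …, z_i) : z_{i₁} z_{i₂} = (z_1, …, z_i) : z_{i₁}` for all `0 ≤ i < i₁ ≤ i₂ ≤ m`.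
Since `Fin m` counts from `0`, the first `i` members are the `z k` with `k < i`, and the condition
`i < i₁` on positions counted from `1` reads `i ≤ i₁`. -/
structure IsPSequence {A : Type*} [CommRing A] {m : ℕ} (z : Fin m → A) : Prop where
  minimal : ∀ j : Fin m, z j ∉ Ideal.span (z '' {k | k ≠ j})
  colon_eq : ∀ (i : ℕ) (i₁ i₂ : Fin m), i ≤ (i₁ : ℕ) → i₁ ≤ i₂ →
    (Ideal.span (z '' {k | (k : ℕ) < i})).colon {z i₁ * z i₂} =
      (Ideal.span (z '' {k | (k : ℕ) < i})).colon {z i₁}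

/-- The level of an edge of a tree rooted at `r`: the distance from the root to the endpoint of the
edge that is farther from the root. -/
noncomputable def edgeLevel {n : ℕ} (T : SimpleGraph (Fin n)) (r : Fin n) (e : Sym2 (Fin n)) : ℕ :=
  (e.map (T.dist r)).sup

/-- `ε` lists the edges of the tree `T` rooted at `r` level by level, and inside each level from
left to right in a plane drawing of the rooted tree.

In the field `leftToRight`, `ε i` and `ε j` are two edges of one level, and `ε i'`, `ε j'` are
the edges of the level before to which they are attached. -/
structure IsLevelOrder {n m : ℕ} (T : SimpleGraph (Fin n)) (r : Fin n)
    (ε : Fin m → Sym2 (Fin n)) : Prop where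
  injective : Function.Injective ε
  range_eq : Set.range ε = T.edgeSet
  level_mono : ∀ i j : Fin m, i ≤ j → edgeLevel T r (ε i) ≤ edgeLevel T r (ε j)
  leftToRight : ∀ i j i' j' : Fin m,
    edgeLevel T r (ε i) = edgeLevel T r (ε j) →
    edgeLevel T r (ε i) = edgeLevel T r (ε i') + 1 →
    edgeLevel T r (ε j) = edgeLevel T r (ε j') + 1 →
    (∃ x, x ∈ ε i ∧ x ∈ ε i') → (∃ y, y ∈ ε j ∧ y ∈ ε j') →
    i < j → i' ≤ j'

/-!
For a graph `H` let `J_H` be the ideal of its edge binomials `f_{ab} = x_a y_b - x_b y_a`, which up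
to sign are the `2`-minors `vertexMinor`.

*Binomial edge ideals are radical.* For every vertex `p`, Ohtani's decomposition
(`relIdeal_eq_inf`) writes `J_H` as the intersection of the ideal of the graph in which the
neighbours of `p` have been joined and of `(x_p, y_p) + J_{H - p}`. When no vertex gives a proper
decomposition the graph is a disjoint union of complete graphs off the deleted vertices, and the
ideal is the kernel of a monomial parametrization (`relIdeal_eq_ker`), hence prime. So `J_H` is
radical; and if the neighbours of `p` are pairwise adjacent, `p` is never deleted, so `x_p` is
regular modulo `J_H` (`relIdeal_isRadical_and_regular`).

*Colon ideals.* If `c` is isolated in `H`, the derivations `∂/∂x_c` and `∂/∂y_c` preserve `J_H`, and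
`g f_{pc} ∈ J_H` gives `g x_p, g y_p ∈ J_H` because `J_H` is radical
(`X_mul_mem_of_vertexMinor_mul_mem`). Suppose that `g f f_{pc} ∈ J_H` for a further edge binomial
`f`. If `p` is on the edge of `f`, then `f ∈ (x_p, y_p)` and `(g f)² ∈ J_H`; if `p` has at most
one neighbour in `H`, then `x_p` is regular modulo `J_H`. In both cases `g f ∈ J_H`. This turns
the colon condition into a combinatorial condition on the order of the edges, `IsFreeEnd`
(`isPSequence_of_isFreeEnd`): each new edge has a new endpoint, and as soon as a vertex has two
edges, its remaining edges follow at once.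

*Orders of the edges.* A level order of a tree satisfies the condition, and the closing edge
`{u, v}` may be appended when `u` is the last vertex, since `v` is pendant. In general an order
that ends with `{u, v}` need not exist. Instead let `q` be the neighbour of `v`, and let `a`
be the neighbour of `q` towards `u`. Begin with `{q, a}` and everything on the side of `a`, then
take `{u, v}`, close the cycle with `{v, q}`, continue with the remaining edges at `q`, and
then move away from `q` (`exists_isUnicyclicRanking`).
-/

open MvPolynomial

/-! ### Binomial edge ideals of relations -/

/-- The `2`-minor `x_a y_b - x_b y_a` of the generic `2 × V` matrix. -/
noncomputable def vertexMinor (K : Type*) [Field K] {V : Type*} (a b : V) :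
    MvPolynomial (V ⊕ V) K :=
  X (Sum.inl a) * X (Sum.inr b) - X (Sum.inl b) * X (Sum.inr a)

/-- The ideal generated by the minors `x_a y_b - x_b y_a` with `r a b` and by both variables
of every vertex in `S`. For `S = ∅` it is the binomial edge ideal of `r`; a larger `S` records
the vertices that have been deleted. -/
noncomputable def relIdeal (K : Type*) [Field K] {V : Type*} (S : Set V) (r : V → V → Prop) :
    Ideal (MvPolynomial (V ⊕ V) K) :=
  Ideal.span {f | (∃ s ∈ S, f = X (Sum.inl s) ∨ f = X (Sum.inr s)) ∨
    ∃ a b, r a b ∧ f = vertexMinor K a b}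

/-- The relation obtained from `r` by joining all pairs of neighbours of `p`. -/
def completeAt {V : Type*} (r : V → V → Prop) (p a b : V) : Prop :=
  r a b ∨ (r p a ∧ r p b)

section Ideals

variable {K : Type*} [Field K] {V : Type*} {S : Set V} {r : V → V → Prop}

lemma X_inl_mem_relIdeal {s : V} (hs : s ∈ S) : X (Sum.inl s) ∈ relIdeal K S r :=
  Ideal.subset_span (Or.inl ⟨s, hs, Or.inl rfl⟩)

lemma X_inr_mem_relIdeal {s : V} (hs : s ∈ S) : X (Sum.inr s) ∈ relIdeal K S r :=
  Ideal.subset_span (Or.inl ⟨s, hs, Or.inr rfl⟩)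

lemma vertexMinor_mem_relIdeal {a b : V} (h : r a b) : vertexMinor K a b ∈ relIdeal K S r :=
  Ideal.subset_span (Or.inr ⟨a, b, h, rfl⟩)

lemma relIdeal_le {I : Ideal (MvPolynomial (V ⊕ V) K)}
    (hl : ∀ s ∈ S, X (Sum.inl s) ∈ I) (hr : ∀ s ∈ S, X (Sum.inr s) ∈ I)
    (hm : ∀ a b, r a b → vertexMinor K a b ∈ I) : relIdeal K S r ≤ I := by
  refine Ideal.span_le.2 ?_
  rintro f (⟨s, hs, rfl | rfl⟩ | ⟨a, b, h, rfl⟩)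
  · exact hl s hs
  · exact hr s hs
  · exact hm a b h

open Classical in
/-- The endomorphism of the polynomial ring that sets both variables of `p` to zero. -/
noncomputable def eraseVertex (K : Type*) [Field K] {V : Type*} (p : V) :
    MvPolynomial (V ⊕ V) K →ₐ[K] MvPolynomial (V ⊕ V) K :=
  aeval (Sum.elim (fun a => if a = p then 0 else X (Sum.inl a))
    (fun a => if a = p then 0 else X (Sum.inr a)))

open Classical in
lemma eraseVertex_X_inl (p a : V) :
    eraseVertex K p (X (Sum.inl a)) = if a = p then 0 else X (Sum.inl a) := by
  simp [eraseVertex]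

open Classical in
lemma eraseVertex_X_inr (p a : V) :
    eraseVertex K p (X (Sum.inr a)) = if a = p then 0 else X (Sum.inr a) := by
  simp [eraseVertex]

lemma sub_eraseVertex_mul_mem {I : Ideal (MvPolynomial (V ⊕ V) K)} {p : V}
    {g : MvPolynomial (V ⊕ V) K} (hl : X (Sum.inl p) * g ∈ I) (hr : X (Sum.inr p) * g ∈ I)
    (h : MvPolynomial (V ⊕ V) K) : (h - eraseVertex K p h) * g ∈ I := by
  induction h using MvPolynomial.induction_on with
  | C a =>
    have : eraseVertex K p (C a : MvPolynomial (V ⊕ V) K) = C a := by simp [eraseVertex]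
    simp [this]
  | add h₁ h₂ ih₁ ih₂ =>
    have : (h₁ + h₂ - eraseVertex K p (h₁ + h₂)) * g =
        (h₁ - eraseVertex K p h₁) * g + (h₂ - eraseVertex K p h₂) * g := by
      rw [map_add]; ring
    rw [this]
    exact I.add_mem ih₁ ih₂
  | mul_X h i ih =>
    have hX : (X i - eraseVertex K p (X i)) * g ∈ I := by
      rcases i with a | a
      · rw [eraseVertex_X_inl]
        split_ifs with ha
        · simpa [ha] using hl
        · simp
      · rw [eraseVertex_X_inr]
        split_ifs with ha
        · simpa [ha] using hr
        · simp
    have : (h * X i - eraseVertex K p (h * X i)) * g =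
        X i * ((h - eraseVertex K p h) * g) +
          eraseVertex K p h * ((X i - eraseVertex K p (X i)) * g) := by
      rw [map_mul]; ring
    rw [this]
    exact I.add_mem (I.mul_mem_left _ ih) (I.mul_mem_left _ hX)

/-- Setting the variables of `p` to zero maps the ideal in which `p` is deleted into the
ideal in which it is kept. -/
lemma eraseVertex_mem {p : V} {g : MvPolynomial (V ⊕ V) K}
    (hg : g ∈ relIdeal K (insert p S) r) : eraseVertex K p g ∈ relIdeal K S r := by
  suffices h : relIdeal K (insert p S) r ≤ (relIdeal K S r).comap (eraseVertex K p) from h hg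
  refine relIdeal_le (fun s hs => ?_) (fun s hs => ?_) (fun a b hab => ?_)
  · rw [Ideal.mem_comap, eraseVertex_X_inl]
    split_ifs with h
    · exact Ideal.zero_mem _
    · exact X_inl_mem_relIdeal (hs.resolve_left h)
  · rw [Ideal.mem_comap, eraseVertex_X_inr]
    split_ifs with h
    · exact Ideal.zero_mem _
    · exact X_inr_mem_relIdeal (hs.resolve_left h)
  · rw [Ideal.mem_comap, vertexMinor, map_sub, map_mul, map_mul, eraseVertex_X_inl,
      eraseVertex_X_inr, eraseVertex_X_inl, eraseVertex_X_inr]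
    by_cases ha : a = p
    · simp [ha]
    by_cases hb : b = p
    · simp [hb]
    simpa [ha, hb, vertexMinor] using vertexMinor_mem_relIdeal (K := K) (S := S) hab

lemma relIdeal_mono {S' : Set V} (h : S ⊆ S') : relIdeal K S r ≤ relIdeal K S' r :=
  relIdeal_le (fun _ hs => X_inl_mem_relIdeal (h hs)) (fun _ hs => X_inr_mem_relIdeal (h hs))
    (fun _ _ hab => vertexMinor_mem_relIdeal hab)

lemma relIdeal_le_completeAt (p : V) : relIdeal K S r ≤ relIdeal K S (completeAt r p) :=
  relIdeal_le (fun _ hs => X_inl_mem_relIdeal hs) (fun _ hs => X_inr_mem_relIdeal hs)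
    (fun _ _ hab => vertexMinor_mem_relIdeal (Or.inl hab))

/-- The variables of `p` multiply the ideal of the completion at `p` into the original ideal,
by the Plücker relations `x_p f_{ab} = x_a f_{pb} - x_b f_{pa}` and
`y_p f_{ab} = y_a f_{pb} - y_b f_{pa}`. -/
lemma X_mul_mem_of_mem_completeAt {p : V} {g : MvPolynomial (V ⊕ V) K}
    (hg : g ∈ relIdeal K S (completeAt r p)) :
    X (Sum.inl p) * g ∈ relIdeal K S r ∧ X (Sum.inr p) * g ∈ relIdeal K S r := by
  set I := relIdeal K S r with hI
  have key : relIdeal K S (completeAt r p) ≤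
      I.colon {X (Sum.inl p)} ⊓ I.colon {X (Sum.inr p)} := by
    refine relIdeal_le (fun s hs => ?_) (fun s hs => ?_) (fun a b hab => ?_)
    · simp only [Submodule.mem_inf, Submodule.mem_colon_singleton, smul_eq_mul]
      exact ⟨I.mul_mem_right _ (X_inl_mem_relIdeal hs), I.mul_mem_right _ (X_inl_mem_relIdeal hs)⟩
    · simp only [Submodule.mem_inf, Submodule.mem_colon_singleton, smul_eq_mul]
      exact ⟨I.mul_mem_right _ (X_inr_mem_relIdeal hs), I.mul_mem_right _ (X_inr_mem_relIdeal hs)⟩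
    · simp only [Submodule.mem_inf, Submodule.mem_colon_singleton, smul_eq_mul]
      rcases hab with hab | ⟨ha, hb⟩
      · exact ⟨I.mul_mem_right _ (vertexMinor_mem_relIdeal hab),
          I.mul_mem_right _ (vertexMinor_mem_relIdeal hab)⟩
      · have h1 : vertexMinor K p a ∈ I := vertexMinor_mem_relIdeal ha
        have h2 : vertexMinor K p b ∈ I := vertexMinor_mem_relIdeal hb
        constructor
        · have : vertexMinor K a b * X (Sum.inl p) =
              X (Sum.inl a) * vertexMinor K p b - X (Sum.inl b) * vertexMinor K p a := by
            simp only [vertexMinor]; ring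
          rw [this]
          exact I.sub_mem (I.mul_mem_left _ h2) (I.mul_mem_left _ h1)
        · have : vertexMinor K a b * X (Sum.inr p) =
              X (Sum.inr a) * vertexMinor K p b - X (Sum.inr b) * vertexMinor K p a := by
            simp only [vertexMinor]; ring
          rw [this]
          exact I.sub_mem (I.mul_mem_left _ h2) (I.mul_mem_left _ h1)
  have := key hg
  simp only [Submodule.mem_inf, Submodule.mem_colon_singleton, smul_eq_mul] at this
  exact ⟨mul_comm g _ ▸ this.1, mul_comm g _ ▸ this.2⟩

lemma sub_eraseVertex_mem_of_mem_completeAt {p : V} {g : MvPolynomial (V ⊕ V) K}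
    (hg : g ∈ relIdeal K S (completeAt r p)) : g - eraseVertex K p g ∈ relIdeal K S r := by
  have hold : ∀ f ∈ relIdeal K S r, f - eraseVertex K p f ∈ relIdeal K S r := fun f hf =>
    Ideal.sub_mem _ hf (eraseVertex_mem (relIdeal_mono (Set.subset_insert _ _) hf))
  induction hg using Submodule.span_induction with
  | mem f hf =>
    rcases hf with hf | ⟨a, b, hab | ⟨ha, hb⟩, rfl⟩
    · exact hold f (Ideal.subset_span (Or.inl hf))
    · exact hold _ (vertexMinor_mem_relIdeal hab)
    · by_cases hap : a = p
      · exact hold _ (vertexMinor_mem_relIdeal (hap ▸ hb))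
      by_cases hbp : b = p
      · have : vertexMinor K a b = -vertexMinor K p a := by
          simp only [vertexMinor, hbp]; ring
        rw [this]
        exact hold _ (neg_mem (vertexMinor_mem_relIdeal ha))
      · have : eraseVertex K p (vertexMinor K a b) = vertexMinor K a b := by
          simp [vertexMinor, eraseVertex_X_inl, eraseVertex_X_inr, hap, hbp]
        simp [this]
  | zero => simp
  | add f g _ _ hf hg =>
    rw [map_add, add_sub_add_comm]
    exact Ideal.add_mem _ hf hg
  | smul h f hmem hf =>
    have : h • f - eraseVertex K p (h • f) =
        (h - eraseVertex K p h) * f + eraseVertex K p h * (f - eraseVertex K p f) := by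
      rw [smul_eq_mul, map_mul]; ring
    rw [this]
    have hX := X_mul_mem_of_mem_completeAt hmem
    exact Ideal.add_mem _ (sub_eraseVertex_mul_mem hX.1 hX.2 h) (Ideal.mul_mem_left _ _ hf)

/-- Ohtani's decomposition: the ideal of a relation is the intersection of the ideal of its
completion at `p` and the ideal in which `p` is deleted. -/
lemma relIdeal_eq_inf (p : V) :
    relIdeal K S r = relIdeal K S (completeAt r p) ⊓ relIdeal K (insert p S) r := by
  refine le_antisymm (le_inf (relIdeal_le_completeAt p) (relIdeal_mono (Set.subset_insert _ _))) ?_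
  rintro g ⟨h₁, h₂⟩
  simpa using Ideal.add_mem _ (sub_eraseVertex_mem_of_mem_completeAt h₁) (eraseVertex_mem h₂)

end Ideals

/-! ### Disjoint unions of complete graphs -/

section Cliques

variable (K : Type*) [Field K] {V ι : Type*}

open Classical in
/-- The parametrization `x_a ↦ t_a s_{c a}`, `y_a ↦ t_a w_{c a}` of pairs of points that are
proportional on each class of `c`; the variables of the vertices in `S` go to zero. The
variables `t`, `s`, `w` are indexed by the three summands. -/
noncomputable def cliqueParam (S : Set V) (c : V → ι) :
    MvPolynomial (V ⊕ V) K →ₐ[K] MvPolynomial (V ⊕ (ι ⊕ ι)) K :=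
  aeval (Sum.elim
    (fun a => if a ∈ S then 0 else X (Sum.inl a) * X (Sum.inr (Sum.inl (c a))))
    (fun a => if a ∈ S then 0 else X (Sum.inl a) * X (Sum.inr (Sum.inr (c a)))))

/-- The exponent vector of the image of a variable under `cliqueParam`. -/
noncomputable def cliqueVarExp (c : V → ι) : V ⊕ V → (V ⊕ (ι ⊕ ι) →₀ ℕ) :=
  Sum.elim (fun a => Finsupp.single (Sum.inl a) 1 + Finsupp.single (Sum.inr (Sum.inl (c a))) 1)
    (fun a => Finsupp.single (Sum.inl a) 1 + Finsupp.single (Sum.inr (Sum.inr (c a))) 1)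

/-- The exponent vector of the image of the monomial with exponents `d` under `cliqueParam`,
when no variable of a vertex in `S` occurs. -/
noncomputable def cliqueExp (c : V → ι) : (V ⊕ V →₀ ℕ) →+ (V ⊕ (ι ⊕ ι) →₀ ℕ) :=
  Finsupp.liftAddHom fun v => (AddMonoidHom.flip (smulAddHom ℕ _)) (cliqueVarExp c v)

variable {K}

lemma cliqueExp_single (c : V → ι) (v : V ⊕ V) :
    cliqueExp c (Finsupp.single v 1) = cliqueVarExp c v := by
  simp [cliqueExp]

lemma cliqueExp_apply (c : V → ι) (d : V ⊕ V →₀ ℕ) (k : V ⊕ (ι ⊕ ι)) :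
    cliqueExp c d k = d.sum fun v n => n * cliqueVarExp c v k := by
  simp [cliqueExp, Finsupp.sum, Finsupp.finsetSum_apply]

lemma cliqueExp_pos_iff (c : V → ι) (d : V ⊕ V →₀ ℕ) (k : V ⊕ (ι ⊕ ι)) :
    cliqueExp c d k ≠ 0 ↔ ∃ v, d v ≠ 0 ∧ cliqueVarExp c v k ≠ 0 := by
  rw [cliqueExp_apply, Finsupp.sum, Ne, Finset.sum_eq_zero_iff]
  simp only [Finsupp.mem_support_iff, mul_eq_zero, not_forall]
  constructor
  · rintro ⟨v, hv, h⟩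
    exact ⟨v, hv, fun h' => h (Or.inr h')⟩
  · rintro ⟨v, hv, h⟩
    exact ⟨v, hv, fun h' => h'.elim hv h⟩

lemma cliqueExp_inl_ne_zero_iff (c : V → ι) (d : V ⊕ V →₀ ℕ) (a : V) :
    cliqueExp c d (Sum.inl a) ≠ 0 ↔ d (Sum.inl a) ≠ 0 ∨ d (Sum.inr a) ≠ 0 := by
  classical
  rw [cliqueExp_pos_iff]
  constructor
  · rintro ⟨v | v, hv, h⟩ <;>
      simp [cliqueVarExp, Finsupp.single_apply] at h <;> subst h
    · exact Or.inl hv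
    · exact Or.inr hv
  · rintro (h | h)
    · exact ⟨_, h, by simp [cliqueVarExp]⟩
    · exact ⟨_, h, by simp [cliqueVarExp]⟩

lemma exists_of_cliqueExp_s {c : V → ι} {d : V ⊕ V →₀ ℕ} {k : ι}
    (h : cliqueExp c d (Sum.inr (Sum.inl k)) ≠ 0) : ∃ a, c a = k ∧ d (Sum.inl a) ≠ 0 := by
  classical
  obtain ⟨v | v, hv, h⟩ := (cliqueExp_pos_iff ..).1 h <;>
    simp [cliqueVarExp, Finsupp.single_apply] at h
  exact ⟨v, h, hv⟩

lemma exists_of_cliqueExp_w {c : V → ι} {d : V ⊕ V →₀ ℕ} {k : ι}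
    (h : cliqueExp c d (Sum.inr (Sum.inr k)) ≠ 0) : ∃ a, c a = k ∧ d (Sum.inr a) ≠ 0 := by
  classical
  obtain ⟨v | v, hv, h⟩ := (cliqueExp_pos_iff ..).1 h <;>
    simp [cliqueVarExp, Finsupp.single_apply] at h
  exact ⟨v, h, hv⟩

lemma exists_eq_single_add {σ : Type*} {d : σ →₀ ℕ} {v : σ} (h : d v ≠ 0) :
    ∃ d', d = Finsupp.single v 1 + d' := by
  classical
  refine ⟨d - Finsupp.single v 1, ?_⟩
  ext w
  by_cases hw : v = w
  · subst hw; simp; omega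
  · simp [hw]

lemma monomial_single_one_add {σ : Type*} (v : σ) (d : σ →₀ ℕ) :
    (monomial (Finsupp.single v 1 + d) 1 : MvPolynomial σ K) = X v * monomial d 1 := by
  rw [X, monomial_mul, one_mul]

/-- Two monomials with the same image under `cliqueParam` are congruent modulo the minors: they
have a variable in common after an exchange `x_a y_b ↔ x_b y_a` inside one class. -/
lemma monomial_sub_mem_of_cliqueExp_eq {I : Ideal (MvPolynomial (V ⊕ V) K)} {S : Set V}
    {c : V → ι} (hI : ∀ a b, a ∉ S → b ∉ S → c a = c b → vertexMinor K a b ∈ I) (N : ℕ) :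
    ∀ d d' : V ⊕ V →₀ ℕ, d.degree = N → (∀ a ∈ S, cliqueExp c d (Sum.inl a) = 0) →
      cliqueExp c d = cliqueExp c d' → (monomial d 1 - monomial d' 1 : MvPolynomial _ K) ∈ I := by
  induction N with
  | zero =>
    intro d d' hd _ h
    have hd0 : d = 0 := (Finsupp.degree_eq_zero_iff d).1 hd
    have hd' : d' = 0 := by
      ext v
      by_contra hv
      rcases v with a | a
      · exact (cliqueExp_inl_ne_zero_iff c d' a).2 (Or.inl hv) (by rw [← h, hd0]; simp)
      · exact (cliqueExp_inl_ne_zero_iff c d' a).2 (Or.inr hv) (by rw [← h, hd0]; simp)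
    simp [hd0, hd']
  | succ N ih =>
    -- The case of a common variable.
    have common : ∀ (v : V ⊕ V) (d d' : V ⊕ V →₀ ℕ), d.degree = N + 1 →
        (∀ a ∈ S, cliqueExp c d (Sum.inl a) = 0) → cliqueExp c d = cliqueExp c d' →
        d v ≠ 0 → d' v ≠ 0 → (monomial d 1 - monomial d' 1 : MvPolynomial _ K) ∈ I := by
      intro v d d' hd hS h hv hv'
      obtain ⟨e, rfl⟩ := exists_eq_single_add hv
      obtain ⟨e', rfl⟩ := exists_eq_single_add hv'
      rw [monomial_single_one_add, monomial_single_one_add, ← mul_sub]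
      refine I.mul_mem_left _ (ih e e' ?_ ?_ ?_)
      · rw [map_add, Finsupp.degree_single] at hd; omega
      · intro a ha
        have := hS a ha
        rw [map_add, Finsupp.add_apply] at this
        omega
      · rw [map_add, map_add] at h
        exact add_left_cancel h
    intro d d' hd hS h
    have hdne : d ≠ 0 := by rintro rfl; simp at hd
    obtain ⟨v, hv⟩ := Finsupp.ne_iff.1 hdne
    rw [Finsupp.zero_apply] at hv
    by_cases hv' : d' v ≠ 0
    · exact common v d d' hd hS h hv hv'
    -- The exchange, for `x_a` and `y_a`.
    rcases v with a | a
    · have hne := (cliqueExp_inl_ne_zero_iff c d a).2 (Or.inl hv)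
      have haS : a ∉ S := fun ha => hne (hS a ha)
      have ha' : d' (Sum.inr a) ≠ 0 :=
        ((cliqueExp_inl_ne_zero_iff c d' a).1 (h ▸ hne)).resolve_left hv'
      obtain ⟨b, hb, hdb⟩ : ∃ b, c b = c a ∧ d (Sum.inr b) ≠ 0 := by
        apply exists_of_cliqueExp_w
        rw [h]
        exact (cliqueExp_pos_iff ..).2 ⟨_, ha', by simp [cliqueVarExp]⟩
      have hbS : b ∉ S := fun h' => (cliqueExp_inl_ne_zero_iff c d b).2 (Or.inr hdb) (hS b h')
      obtain ⟨e₁, rfl⟩ := exists_eq_single_add hv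
      obtain ⟨e, rfl⟩ : ∃ e, e₁ = Finsupp.single (Sum.inr b) 1 + e :=
        exists_eq_single_add (by simpa using hdb)
      set d₂ : V ⊕ V →₀ ℕ :=
        Finsupp.single (Sum.inl b) 1 + (Finsupp.single (Sum.inr a) 1 + e) with hd₂
      have hexp : cliqueExp c (Finsupp.single (Sum.inl a) 1 +
          (Finsupp.single (Sum.inr b) 1 + e)) = cliqueExp c d₂ := by
        simp only [hd₂, map_add, cliqueExp_single, cliqueVarExp, Sum.elim_inl, Sum.elim_inr, hb]
        abel
      have h₁ : (monomial (Finsupp.single (Sum.inl a) 1 + (Finsupp.single (Sum.inr b) 1 + e)) 1 -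
          monomial d₂ 1 : MvPolynomial _ K) ∈ I := by
        have : (monomial (Finsupp.single (Sum.inl a) 1 + (Finsupp.single (Sum.inr b) 1 + e)) 1 -
          monomial d₂ 1 : MvPolynomial _ K) = monomial e 1 * vertexMinor K a b := by
          simp only [hd₂, monomial_single_one_add, vertexMinor]; ring
        rw [this]
        exact I.mul_mem_left _ (hI a b haS hbS hb.symm)
      have h₂ := common (Sum.inr a) d₂ d' (by
        rw [hd₂]; simp only [map_add, Finsupp.degree_single] at hd ⊢; omega)
        (by rw [← hexp]; exact hS) (by rw [← hexp, h]) (by simp [hd₂]) ha'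
      simpa using I.add_mem h₁ h₂
    · have hne := (cliqueExp_inl_ne_zero_iff c d a).2 (Or.inr hv)
      have haS : a ∉ S := fun ha => hne (hS a ha)
      have ha' : d' (Sum.inl a) ≠ 0 :=
        ((cliqueExp_inl_ne_zero_iff c d' a).1 (h ▸ hne)).resolve_right hv'
      obtain ⟨b, hb, hdb⟩ : ∃ b, c b = c a ∧ d (Sum.inl b) ≠ 0 := by
        apply exists_of_cliqueExp_s
        rw [h]
        exact (cliqueExp_pos_iff ..).2 ⟨_, ha', by simp [cliqueVarExp]⟩
      have hbS : b ∉ S := fun h' => (cliqueExp_inl_ne_zero_iff c d b).2 (Or.inl hdb) (hS b h')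
      obtain ⟨e₁, rfl⟩ := exists_eq_single_add hv
      obtain ⟨e, rfl⟩ : ∃ e, e₁ = Finsupp.single (Sum.inl b) 1 + e :=
        exists_eq_single_add (by simpa using hdb)
      set d₂ : V ⊕ V →₀ ℕ :=
        Finsupp.single (Sum.inr b) 1 + (Finsupp.single (Sum.inl a) 1 + e) with hd₂
      have hexp : cliqueExp c (Finsupp.single (Sum.inr a) 1 +
          (Finsupp.single (Sum.inl b) 1 + e)) = cliqueExp c d₂ := by
        simp only [hd₂, map_add, cliqueExp_single, cliqueVarExp, Sum.elim_inl, Sum.elim_inr, hb]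
        abel
      have h₁ : (monomial (Finsupp.single (Sum.inr a) 1 + (Finsupp.single (Sum.inl b) 1 + e)) 1 -
          monomial d₂ 1 : MvPolynomial _ K) ∈ I := by
        have : (monomial (Finsupp.single (Sum.inr a) 1 + (Finsupp.single (Sum.inl b) 1 + e)) 1 -
          monomial d₂ 1 : MvPolynomial _ K) = monomial e 1 * vertexMinor K b a := by
          simp only [hd₂, monomial_single_one_add, vertexMinor]; ring
        rw [this]
        exact I.mul_mem_left _ (hI b a hbS haS hb)
      have h₂ := common (Sum.inl a) d₂ d' (by
        rw [hd₂]; simp only [map_add, Finsupp.degree_single] at hd ⊢; omega)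
        (by rw [← hexp]; exact hS) (by rw [← hexp, h]) (by simp [hd₂]) ha'
      simpa using I.add_mem h₁ h₂

open Classical in
lemma cliqueParam_X (S : Set V) (c : V → ι) (v : V ⊕ V) :
    cliqueParam K S c (X v) =
      if Sum.elim id id v ∈ S then 0 else monomial (cliqueVarExp c v) 1 := by
  have hmul : ∀ i j : V ⊕ (ι ⊕ ι), (X i * X j : MvPolynomial (V ⊕ (ι ⊕ ι)) K) =
      monomial (Finsupp.single i 1 + Finsupp.single j 1) 1 := fun i j => by
    rw [X, X, monomial_mul, one_mul]
  rcases v with a | a <;> simp [cliqueParam, cliqueVarExp, hmul] <;> congr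

lemma cliqueParam_monomial {S : Set V} {c : V → ι} {d : V ⊕ V →₀ ℕ}
    (hd : ∀ a ∈ S, cliqueExp c d (Sum.inl a) = 0) :
    cliqueParam K S c (monomial d 1) = monomial (cliqueExp c d) 1 := by
  have hv : ∀ v ∈ d.support, Sum.elim id id v ∉ S := by
    rintro (a | a) hv ha
    · exact (cliqueExp_inl_ne_zero_iff c d a).2 (Or.inl (Finsupp.mem_support_iff.1 hv)) (hd a ha)
    · exact (cliqueExp_inl_ne_zero_iff c d a).2 (Or.inr (Finsupp.mem_support_iff.1 hv)) (hd a ha)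
  rw [monomial_eq, C_1, one_mul, Finsupp.prod, map_prod]
  have : ∀ v ∈ d.support, cliqueParam K S c (X v ^ d v) =
      (monomial (d v • cliqueVarExp c v) 1 : MvPolynomial _ K) := by
    intro v h
    rw [map_pow, cliqueParam_X, if_neg (hv v h), monomial_pow, one_pow]
  rw [Finset.prod_congr rfl this, ← monomial_sum_one]
  simp [cliqueExp, Finsupp.sum]

/-- The ideal of a disjoint union of complete graphs is the kernel of its parametrization. A
left inverse modulo the ideal sends a monomial of the target to the class of any monomial above
it. -/
lemma ker_cliqueParam_le {I : Ideal (MvPolynomial (V ⊕ V) K)} {S : Set V} {c : V → ι}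
    (hl : ∀ s ∈ S, X (Sum.inl s) ∈ I) (hr : ∀ s ∈ S, X (Sum.inr s) ∈ I)
    (hI : ∀ a b, a ∉ S → b ∉ S → c a = c b → vertexMinor K a b ∈ I) :
    RingHom.ker (cliqueParam K S c) ≤ I := by
  classical
  let ψ : MvPolynomial (V ⊕ (ι ⊕ ι)) K →ₗ[K] (MvPolynomial (V ⊕ V) K ⧸ I) :=
    (basisMonomials _ K).constr K fun e =>
      if h : ∃ d, cliqueExp c d = e then Ideal.Quotient.mk I (monomial h.choose 1) else 0
  have hψ : ψ ∘ₗ (cliqueParam K S c).toLinearMap = (Ideal.Quotient.mkₐ K I).toLinearMap := by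
    refine (basisMonomials (V ⊕ V) K).ext fun d => ?_
    simp only [coe_basisMonomials, LinearMap.comp_apply, AlgHom.toLinearMap_apply,
      Ideal.Quotient.mkₐ_eq_mk]
    by_cases hd : ∀ a ∈ S, cliqueExp c d (Sum.inl a) = 0
    · rw [cliqueParam_monomial hd]
      have h : ∃ d', cliqueExp c d' = cliqueExp c d := ⟨d, rfl⟩
      have : ψ (monomial (cliqueExp c d) 1) = Ideal.Quotient.mk I (monomial h.choose 1) := by
        have := (basisMonomials (V ⊕ (ι ⊕ ι)) K).constr_basis K (fun e =>
          if h : ∃ d, cliqueExp c d = e then Ideal.Quotient.mk I (monomial h.choose 1) else 0)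
          (cliqueExp c d)
        rw [coe_basisMonomials, dif_pos h] at this
        exact this
      rw [this, eq_comm, Ideal.Quotient.eq]
      exact monomial_sub_mem_of_cliqueExp_eq hI _ d _ rfl hd h.choose_spec.symm
    · push Not at hd
      obtain ⟨a, ha, hda⟩ := hd
      obtain ⟨v, hv, hvS⟩ : ∃ v, d v ≠ 0 ∧ Sum.elim id id v ∈ S := by
        rcases (cliqueExp_inl_ne_zero_iff c d a).1 hda with h | h
        · exact ⟨_, h, ha⟩
        · exact ⟨_, h, ha⟩
      obtain ⟨e, rfl⟩ := exists_eq_single_add hv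
      have hX : X v ∈ I := by
        rcases v with b | b
        · exact hl b hvS
        · exact hr b hvS
      rw [monomial_single_one_add, map_mul, cliqueParam_X, if_pos hvS, zero_mul, map_zero, eq_comm,
        Ideal.Quotient.eq_zero_iff_mem]
      exact I.mul_mem_right _ hX
  intro g hg
  have := LinearMap.congr_fun hψ g
  simp only [LinearMap.comp_apply, AlgHom.toLinearMap_apply, Ideal.Quotient.mkₐ_eq_mk] at this
  rw [(RingHom.mem_ker).1 hg, map_zero] at this
  exact Ideal.Quotient.eq_zero_iff_mem.1 this.symm

end Cliques

/-! ### Binomial edge ideals are radical -/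

section Radical

variable {K : Type*} [Field K] {V : Type*}

/-- A vertex is simplicial when its neighbours are pairwise related. -/
def IsSimplicialVertex (r : V → V → Prop) (p : V) : Prop :=
  ∀ a b, r p a → r p b → r a b

lemma IsSimplicialVertex.completeAt {r : V → V → Prop} (hs : ∀ a b, r a b → r b a) {p : V}
    (hp : IsSimplicialVertex r p) (q : V) : IsSimplicialVertex (completeAt r q) p := by
  rintro a b (ha | ⟨hqp, hqa⟩) (hb | ⟨hqp', hqb⟩)
  · exact Or.inl (hp a b ha hb)
  · exact Or.inr ⟨hp q a (hs _ _ hqp') ha, hqb⟩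
  · exact Or.inr ⟨hqa, hp q b (hs _ _ hqp) hb⟩
  · exact Or.inr ⟨hqa, hqb⟩

/-- If the relation is transitive off `S`, its ideal is prime and contains no variable `x_p` with
`p ∉ S`. -/
lemma relIdeal_eq_ker {S : Set V} {r : V → V → Prop} (hrefl : ∀ a, r a a)
    (hsymm : ∀ a b, r a b → r b a)
    (htrans : ∀ p a b, p ∉ S → a ∉ S → b ∉ S → r p a → r p b → r a b) :
    relIdeal K S r = RingHom.ker (cliqueParam K S fun a => {b | b ∉ S ∧ r a b}) := by
  refine le_antisymm ?_ (ker_cliqueParam_le (fun _ => X_inl_mem_relIdeal)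
    (fun _ => X_inr_mem_relIdeal) fun a b ha hb hab => ?_)
  · refine relIdeal_le (fun s hs => ?_) (fun s hs => ?_) (fun a b hab => ?_)
    · simp [RingHom.mem_ker, cliqueParam, hs]
    · simp [RingHom.mem_ker, cliqueParam, hs]
    · rw [RingHom.mem_ker]
      by_cases ha : a ∈ S
      · simp [vertexMinor, cliqueParam, ha]
      by_cases hb : b ∈ S
      · simp [vertexMinor, cliqueParam, hb]
      have : {d | d ∉ S ∧ r a d} = {d | d ∉ S ∧ r b d} := by
        ext d
        constructor
        · rintro ⟨hd, h⟩
          exact ⟨hd, htrans a b d ha hb hd hab h⟩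
        · rintro ⟨hd, h⟩
          exact ⟨hd, htrans b a d hb ha hd (hsymm _ _ hab) h⟩
      simp only [vertexMinor, cliqueParam, map_sub, map_mul, aeval_X, Sum.elim_inl, Sum.elim_inr,
        ha, hb, if_false, this]
      ring
  · have h : b ∈ {d | d ∉ S ∧ r b d} := ⟨hb, hrefl b⟩
    rw [← hab] at h
    exact vertexMinor_mem_relIdeal h.2

/-- By Ohtani's decomposition the ideal of any graph is an intersection of ideals of disjoint
unions of complete graphs; a simplicial vertex is never deleted on the way and stays simplicial. -/
theorem relIdeal_isRadical_and_regular [Finite V] : ∀ (S : Set V) (r : V → V → Prop),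
    (∀ a, r a a) → (∀ a b, r a b → r b a) →
    (relIdeal K S r).IsRadical ∧ ∀ p ∉ S, IsSimplicialVertex r p →
      ∀ g, X (Sum.inl p) * g ∈ relIdeal K S r → g ∈ relIdeal K S r := by
  intro S
  induction hn : Sᶜ.ncard using Nat.strong_induction_on generalizing S with
  | _ n ihn =>
  intro r
  induction hm : {x : V × V | ¬ r x.1 x.2}.ncard using Nat.strong_induction_on generalizing r with
  | _ m ihm =>
  intro hrefl hsymm
  by_cases htrans : ∀ p a b, p ∉ S → a ∉ S → b ∉ S → r p a → r p b → r a b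
  · rw [relIdeal_eq_ker hrefl hsymm htrans]
    have hprime := RingHom.ker_isPrime (cliqueParam K S fun a => {b | b ∉ S ∧ r a b}).toRingHom
    refine ⟨hprime.isRadical, fun p hp _ g hg => (hprime.mem_or_mem hg).resolve_left fun h => ?_⟩
    have h' : cliqueParam K S (fun a => {b | b ∉ S ∧ r a b}) (X (Sum.inl p)) = 0 := h
    simp [cliqueParam, hp, X_ne_zero] at h'
  · push Not at htrans
    obtain ⟨q, a, b, hq, ha, hb, hqa, hqb, hab⟩ := htrans
    rw [relIdeal_eq_inf q]
    obtain ⟨rad₁, reg₁⟩ := ihm _ (by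
      rw [← hm]
      refine Set.ncard_lt_ncard ?_ (Set.toFinite _)
      refine ⟨fun x hx h => hx (Or.inl h), fun h => ?_⟩
      exact h (a := (a, b)) hab (Or.inr ⟨hqa, hqb⟩)) (completeAt r q) rfl
      (fun a => Or.inl (hrefl a))
      (fun a b h => h.elim (fun h => Or.inl (hsymm _ _ h)) fun h => Or.inr ⟨h.2, h.1⟩)
    obtain ⟨rad₂, reg₂⟩ := ihn _ (by
      rw [← hn]
      refine Set.ncard_lt_ncard ?_ (Set.toFinite _)
      exact compl_lt_compl_iff_lt.2 (Set.ssubset_insert hq)) (insert q S) rfl r hrefl hsymm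
    refine ⟨rad₁.inf rad₂, fun p hp hsimp g hg => ⟨?_, ?_⟩⟩
    · exact reg₁ p hp (hsimp.completeAt hsymm q) g hg.1
    · refine reg₂ p ?_ hsimp g hg.2
      -- `q` is not simplicial, so it is not `p`.
      rintro (rfl | h)
      · exact hab (hsimp a b hqa hqb)
      · exact hp h

/-- If a minor `f_{pc}` multiplies `g` into a radical ideal whose generators do not involve `c`,
then so do `x_p` and `y_p`: apply the derivations `∂/∂y_c` and `∂/∂x_c`, which preserve the
ideal, and multiply by `g`. -/
lemma X_mul_mem_of_vertexMinor_mul_mem {I : Ideal (MvPolynomial (V ⊕ V) K)} (hI : I.IsRadical)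
    {p c : V} (hpc : p ≠ c)
    (hx : ∀ f ∈ I, pderiv (Sum.inl c) f ∈ I) (hy : ∀ f ∈ I, pderiv (Sum.inr c) f ∈ I)
    {g : MvPolynomial (V ⊕ V) K} (hg : g * vertexMinor K p c ∈ I) :
    X (Sum.inl p) * g ∈ I ∧ X (Sum.inr p) * g ∈ I := by
  classical
  have key : ∀ v, pderiv v (g * vertexMinor K p c) ∈ I →
      pderiv v (vertexMinor K p c) * g ∈ I := by
    intro v hv
    refine hI ⟨2, ?_⟩
    have : (pderiv v (vertexMinor K p c) * g) ^ 2 =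
        (g * pderiv v (vertexMinor K p c)) * pderiv v (g * vertexMinor K p c) -
        (pderiv v (vertexMinor K p c) * pderiv v g) * (g * vertexMinor K p c) := by
      rw [pderiv_mul]; ring
    rw [this]
    exact I.sub_mem (I.mul_mem_left _ hv) (I.mul_mem_left _ hg)
  constructor
  · have := key _ (hy _ hg)
    simpa [vertexMinor, pderiv_mul, pderiv_X, Pi.single_apply, hpc] using this
  · have := key _ (hx _ hg)
    simpa [vertexMinor, pderiv_mul, pderiv_X, Pi.single_apply, hpc] using this

lemma pderiv_mem_relIdeal {r : V → V → Prop} {c : V} (hs : ∀ a b, r a b → r b a)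
    (hc : ∀ a, r c a → c = a) {v : V ⊕ V} (hv : v = Sum.inl c ∨ v = Sum.inr c)
    {f : MvPolynomial (V ⊕ V) K} (hf : f ∈ relIdeal K ∅ r) : pderiv v f ∈ relIdeal K ∅ r := by
  classical
  induction hf using Submodule.span_induction with
  | mem f hf =>
    obtain ⟨a, b, hab, rfl⟩ := hf.resolve_left (by simp)
    have : pderiv v (vertexMinor K a b) = 0 := by
      by_cases h : a = b
      · subst h; simp [vertexMinor]
      have ha : a ≠ c := by rintro rfl; exact h (hc _ hab)
      have hb : b ≠ c := by rintro rfl; exact h (hc _ (hs _ _ hab)).symm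
      rcases hv with rfl | rfl <;>
        simp [vertexMinor, pderiv_X, ha, hb]
    simp [this]
  | zero => simp
  | add f g _ _ hf hg => rw [map_add]; exact Ideal.add_mem _ hf hg
  | smul h f hmem hf =>
    rw [smul_eq_mul, pderiv_mul]
    exact Ideal.add_mem _ (Ideal.mul_mem_left _ _ hmem) (Ideal.mul_mem_left _ _ hf)

end Radical

/-! ### A criterion for `p`-sequences of edge binomials -/

section Criterion

variable {K : Type*} [Field K] {n N : ℕ}

lemma edgeBinomial_mk (a b : Fin n) :
    edgeBinomial K s(a, b) = vertexMinor K a b ∨ edgeBinomial K s(a, b) = -vertexMinor K a b := by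
  rcases le_total a b with h | h
  · left; simp [edgeBinomial, vertexMinor, h]
  · right; simp [edgeBinomial, vertexMinor, h]

/-- The ideal of a set of edges is the ideal of the reflexive relation of these edges; the
diagonal contributes only the zero minors. -/
lemma span_edgeBinomial (ε : Fin N → Sym2 (Fin n)) (A : Set (Fin N)) :
    Ideal.span ((fun k => edgeBinomial K (ε k)) '' A) =
      relIdeal K ∅ (fun a b => a = b ∨ s(a, b) ∈ ε '' A) := by
  refine le_antisymm (Ideal.span_le.2 ?_) (relIdeal_le (by simp) (by simp) ?_)
  · rintro _ ⟨k, hk, rfl⟩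
    simp only [SetLike.mem_coe]
    induction h : ε k with
    | _ a b =>
    have hm : vertexMinor K a b ∈ relIdeal K ∅ (fun a b => a = b ∨ s(a, b) ∈ ε '' A) :=
      vertexMinor_mem_relIdeal (Or.inr ⟨k, hk, h⟩)
    rcases edgeBinomial_mk (K := K) a b with h' | h' <;> rw [h']
    · exact hm
    · exact neg_mem hm
  · rintro a b (rfl | ⟨k, hk, h⟩)
    · simp [vertexMinor]
    · have hm := Ideal.subset_span (α := MvPolynomial (Fin n ⊕ Fin n) K)
        (Set.mem_image_of_mem (fun k => edgeBinomial K (ε k)) hk)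
      simp only [h, SetLike.mem_coe] at hm
      rcases edgeBinomial_mk (K := K) a b with h' | h' <;> rw [h'] at hm
      · exact hm
      · exact neg_mem_iff.1 hm

/-- Evaluating at the point `x_a = y_b = 1`, all other coordinates `0`, kills every edge binomial
but the one of `{a, b}`. -/
lemma edgeBinomial_notMem_span {ε : Fin N → Sym2 (Fin n)} (hinj : Function.Injective ε)
    (hdiag : ∀ k, ¬ (ε k).IsDiag) (j : Fin N) :
    edgeBinomial K (ε j) ∉ Ideal.span ((fun k => edgeBinomial K (ε k)) '' {k | k ≠ j}) := by
  classical
  induction hj : ε j with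
  | _ a b =>
  have hab : a ≠ b := by simpa [hj] using hdiag j
  let φ : MvPolynomial (Fin n ⊕ Fin n) K →ₐ[K] K :=
    aeval (Sum.elim (fun c => if c = a then 1 else 0) (fun c => if c = b then 1 else 0))
  have hφ : ∀ c d, φ (vertexMinor K c d) =
      (if c = a then 1 else 0) * (if d = b then 1 else 0) -
        (if d = a then 1 else 0) * (if c = b then 1 else 0) := by
    intro c d; simp [φ, vertexMinor]
  intro hmem
  have hle : Ideal.span ((fun k => edgeBinomial K (ε k)) '' {k | k ≠ j}) ≤ RingHom.ker φ := by
    refine Ideal.span_le.2 ?_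
    rintro _ ⟨k, hk, rfl⟩
    simp only [SetLike.mem_coe, RingHom.mem_ker]
    induction h : ε k with
    | _ c d =>
    have hne : s(c, d) ≠ s(a, b) := by
      rw [← h, ← hj]; exact fun h => hk (hinj h)
    have : φ (vertexMinor K c d) = 0 := by
      rw [hφ]
      simp only [ne_eq, Sym2.eq_iff, not_or, not_and] at hne
      by_cases h1 : c = a <;> by_cases h2 : d = b <;> by_cases h3 : d = a <;>
        by_cases h4 : c = b <;> simp_all
    rcases edgeBinomial_mk (K := K) c d with h' | h' <;> rw [h'] <;> simp [this]
  have h0 := hle hmem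
  rw [RingHom.mem_ker] at h0
  have h1 : φ (vertexMinor K a b) = 1 := by rw [hφ]; simp [hab]
  rcases edgeBinomial_mk (K := K) a b with h' | h' <;> rw [h'] at h0 <;> simp [h1] at h0

/-- `c` is on no edge before position `i`, and `p` is on edge `i` or on at most one edge before
position `i`. If `{p, c}` is an edge at a position after `i`, then its binomial cannot enlarge the
colon ideals by the binomial at `i`: `J : f_{pc} = J : (x_p, y_p)` for the ideal `J` of
the edges before `i`, and either `f_i ∈ (x_p, y_p)` or `x_p` is regular modulo `J`. -/
def IsFreeEnd (ε : Fin N → Sym2 (Fin n)) (i : Fin N) (p c : Fin n) : Prop :=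
  (∀ k < i, c ∉ ε k) ∧
    (p ∈ ε i ∨ ∀ k < i, ∀ k' < i, p ∈ ε k → p ∈ ε k' → k = k')

theorem isPSequence_of_isFreeEnd {ε : Fin N → Sym2 (Fin n)} (hinj : Function.Injective ε)
    (hdiag : ∀ k, ¬ (ε k).IsDiag)
    (h : ∀ i j, i < j → ∃ p c, ε j = s(p, c) ∧ IsFreeEnd ε i p c) :
    IsPSequence (fun k => edgeBinomial K (ε k)) := by
  refine ⟨fun j => edgeBinomial_notMem_span hinj hdiag j, fun i i₁ i₂ hi₁ hi₂ => ?_⟩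
  rw [span_edgeBinomial]
  set r : Fin n → Fin n → Prop := fun a b => a = b ∨ s(a, b) ∈ ε '' {k | (k : ℕ) < i} with hr
  set J := relIdeal K ∅ r with hJ
  have hrefl : ∀ a, r a a := fun a => Or.inl rfl
  have hsymm : ∀ a b, r a b → r b a := by
    rintro a b (rfl | h)
    · exact Or.inl rfl
    · exact Or.inr (by rwa [Sym2.eq_swap])
  obtain ⟨hrad, hreg⟩ := relIdeal_isRadical_and_regular (K := K) ∅ r hrefl hsymm
  ext g
  simp only [Submodule.mem_colon_singleton, smul_eq_mul]
  refine ⟨fun hg => ?_, fun hg => by rw [← mul_assoc]; exact J.mul_mem_right _ hg⟩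
  rcases hi₂.eq_or_lt with rfl | hlt
  · refine hrad ⟨2, ?_⟩
    have : (g * edgeBinomial K (ε i₁)) ^ 2 =
        g * (g * (edgeBinomial K (ε i₁) * edgeBinomial K (ε i₁))) := by ring
    rw [this]
    exact J.mul_mem_left _ hg
  obtain ⟨p, c, hpc, hc, hp⟩ := h i₁ i₂ hlt
  have hne : p ≠ c := by simpa [hpc] using hdiag i₂
  have hbefore : ∀ k : Fin N, (k : ℕ) < i → k < i₁ := fun k hk =>
    Fin.lt_def.2 (lt_of_lt_of_le hk hi₁)
  have hciso : ∀ a, r c a → c = a := by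
    rintro a (rfl | ⟨k, hk, hka⟩)
    · rfl
    · exact (hc k (hbefore k hk) (by rw [hka]; simp)).elim
  have hg' : (g * edgeBinomial K (ε i₁)) * vertexMinor K p c ∈ J := by
    rw [hpc] at hg
    rcases edgeBinomial_mk (K := K) p c with h' | h' <;> rw [h'] at hg
    · rwa [mul_assoc]
    · rw [← neg_mem_iff]
      convert hg using 1
      ring
  obtain ⟨hX, hY⟩ := X_mul_mem_of_vertexMinor_mul_mem hrad hne
    (fun f => pderiv_mem_relIdeal hsymm hciso (Or.inl rfl))
    (fun f => pderiv_mem_relIdeal hsymm hciso (Or.inr rfl)) hg'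
  rcases hp with hp | hp
  · -- The binomial at `i₁` is in `(x_p, y_p)`, so the square of `g * f` is in `J`.
    obtain ⟨a, ha⟩ := hp
    refine hrad ⟨2, ?_⟩
    have hm : (g * edgeBinomial K (ε i₁)) * vertexMinor K p a ∈ J := by
      have : (g * edgeBinomial K (ε i₁)) * vertexMinor K p a =
          X (Sum.inr a) * (X (Sum.inl p) * (g * edgeBinomial K (ε i₁))) -
          X (Sum.inl a) * (X (Sum.inr p) * (g * edgeBinomial K (ε i₁))) := by
        simp only [vertexMinor]; ring
      rw [this]
      exact J.sub_mem (J.mul_mem_left _ hX) (J.mul_mem_left _ hY)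
    have hsq : g * (g * edgeBinomial K (ε i₁) * vertexMinor K p a) ∈ J := J.mul_mem_left _ hm
    rw [ha] at hsq ⊢
    rcases edgeBinomial_mk (K := K) p a with h' | h' <;> rw [h'] at hsq ⊢
    · convert hsq using 1
      ring
    · rw [← neg_mem_iff]
      convert hsq using 1
      ring
  · refine hreg p (by simp) ?_ _ hX
    rintro a b (rfl | ⟨k, hk, hka⟩) (rfl | ⟨k', hk', hkb⟩)
    · exact Or.inl rfl
    · exact Or.inr ⟨k', hk', hkb⟩
    · exact Or.inr ⟨k, hk, by rw [hka, Sym2.eq_swap]⟩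
    · left
      have := hp k (hbefore k hk) k' (hbefore k' hk') (by simp [hka]) (by simp [hkb])
      subst this
      exact Sym2.congr_right.1 (hka.symm.trans hkb)

end Criterion

/-! ### Distances in trees -/

namespace SimpleGraph

variable {V : Type*} {T : SimpleGraph V}

/-- In a rooted tree every vertex has at most one neighbour closer to the root. -/
lemma IsTree.eq_of_adj_of_dist_lt (hT : T.IsTree) {r x y z : V} (hy : T.Adj x y)
    (hz : T.Adj x z) (hyr : T.dist r y < T.dist r x) (hzr : T.dist r z < T.dist r x) : y = z := by
  obtain ⟨p, hp, hpl⟩ := hT.connected.exists_path_of_dist r x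
  have key : ∀ w, T.Adj x w → T.dist r w < T.dist r x → w = p.penultimate := by
    intro w hw hwr
    obtain ⟨q, hq, hql⟩ := hT.connected.exists_path_of_dist r w
    have hx : x ∉ q.support := by
      intro hx
      have h := congrArg Walk.length (hT.isAcyclic.path_concat hp hq hw hx)
      rw [Walk.length_concat] at h
      omega
    exact hT.isAcyclic.eq_penultimate_of_adj_end hp hw
      (hT.isAcyclic.mem_support_of_ne_mem_support_of_adj_of_isPath hp hq hw hx)
  rw [key y hy hyr, key z hz hzr]

lemma Connected.exists_adj_dist_add_one (hT : T.Connected) {r x : V} (h : x ≠ r) :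
    ∃ y, T.Adj x y ∧ T.dist r y + 1 = T.dist r x := by
  obtain ⟨p, -, hp⟩ := hT.exists_path_of_dist r x
  have hnil : ¬ p.Nil := Walk.not_nil_of_ne h.symm
  refine ⟨p.penultimate, (p.adj_penultimate hnil).symm, ?_⟩
  have h1 : T.dist r p.penultimate ≤ p.length - 1 := by
    have := dist_le p.dropLast
    simpa using this
  have h2 : T.dist r x ≤ T.dist r p.penultimate + T.dist p.penultimate x := hT.dist_triangle
  rw [dist_eq_one_iff_adj.2 (p.adj_penultimate hnil)] at h2
  have h3 : 0 < T.dist r x := hT.pos_dist_of_ne h.symm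
  omega

/-- An edge of a tree along which the nearer endpoint of the edge `{a, q}` changes from `a` to
`q` is this edge. -/
lemma IsTree.eq_and_eq_of_dist_lt (hT : T.IsTree) {a q x y : V} (haq : T.Adj q a)
    (hxy : T.Adj x y) (hx : T.dist a x < T.dist q x) (hy : ¬ T.dist a y < T.dist q y) :
    x = a ∧ y = q := by
  have e1 := hT.dist_eq_dist_add_one_of_adj a hxy
  have e2 := hT.dist_eq_dist_add_one_of_adj q hxy
  have e3 := hT.dist_eq_dist_add_one_of_adj x haq
  have e4 := hT.dist_eq_dist_add_one_of_adj y haq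
  rw [dist_comm (v := q), dist_comm (v := a)] at e3 e4
  have hxa : x = a := by
    by_contra hne
    obtain ⟨z, hz, hza⟩ := hT.connected.exists_adj_dist_add_one hne
    have e5 := hT.dist_eq_dist_add_one_of_adj z haq
    rw [dist_comm (v := q), dist_comm (v := a)] at e5
    have := hT.eq_of_adj_of_dist_lt (r := q) hxy hz (by omega) (by omega)
    subst this
    omega
  subst hxa
  refine ⟨rfl, ?_⟩
  rw [dist_self] at *
  have : T.dist q y = 0 := by omega
  exact (hT.connected.dist_eq_zero_iff.1 this).symm

lemma exists_mem_adj_of_mem_edgeSet {e : Sym2 V} {x : V} (he : e ∈ T.edgeSet) (hx : x ∈ e) :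
    ∃ y, e = s(x, y) ∧ T.Adj x y := by
  obtain ⟨y, rfl⟩ := hx
  exact ⟨y, rfl, he⟩

end SimpleGraph

/-! ### Level orders of trees -/

section LevelOrder

variable {n m : ℕ} {T : SimpleGraph (Fin n)} {r : Fin n}

lemma edgeLevel_of_dist {p c : Fin n} (h : T.dist r c = T.dist r p + 1) :
    edgeLevel T r s(p, c) = T.dist r c := by
  simp [edgeLevel, h]

/-- In a level order, the lower endpoint of an edge is new when the edge appears, and the
edges below a vertex are consecutive. -/
lemma IsLevelOrder.exists_isFreeEnd (hT : T.IsTree) {ε : Fin m → Sym2 (Fin n)}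
    (hε : IsLevelOrder T r ε) {i j : Fin m} (hij : i < j) :
    ∃ p c, ε j = s(p, c) ∧ IsFreeEnd ε i p c := by
  have hmem : ∀ k, ε k ∈ T.edgeSet := fun k => hε.range_eq ▸ Set.mem_range_self k
  -- Every edge has an upper and a lower endpoint.
  have hrep : ∀ k, ∃ p c, ε k = s(p, c) ∧ T.Adj p c ∧ T.dist r c = T.dist r p + 1 := by
    intro k
    have hk := hmem k
    induction h : ε k with
    | _ a b =>
    rw [h] at hk
    have hab : T.Adj a b := hk
    rcases hT.dist_eq_dist_add_one_of_adj r hab with h' | h'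
    · exact ⟨b, a, Sym2.eq_swap, hab.symm, h'⟩
    · exact ⟨a, b, rfl, hab, h'⟩
  have hparent : ∀ x, x ≠ r → ∃ k y, ε k = s(y, x) ∧ T.Adj x y ∧ T.dist r y + 1 = T.dist r x := by
    intro x hx
    obtain ⟨y, hxy, hy⟩ := hT.connected.exists_adj_dist_add_one hx
    have : s(y, x) ∈ Set.range ε := by rw [hε.range_eq]; exact hxy.symm
    obtain ⟨k, hk⟩ := this
    exact ⟨k, y, hk, hxy, hy⟩
  obtain ⟨p, c, hj, hpc, hd⟩ := hrep j
  have hlj : edgeLevel T r (ε j) = T.dist r c := by rw [hj, edgeLevel_of_dist hd]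
  refine ⟨p, c, hj, fun k hk hck => ?_, ?_⟩
  · obtain ⟨x, hx, hcx⟩ := SimpleGraph.exists_mem_adj_of_mem_edgeSet (hmem k) hck
    rcases hT.dist_eq_dist_add_one_of_adj r hcx with h | h
    · have : x = p := hT.eq_of_adj_of_dist_lt (r := r) hcx hpc.symm (by omega) (by omega)
      subst this
      have : k = j := hε.injective (by rw [hx, hj, Sym2.eq_swap])
      omega
    · have := hε.level_mono k j (by omega)
      rw [hlj, hx, edgeLevel_of_dist h] at this
      omega
  · by_cases hpi : p ∈ ε i
    · exact Or.inl hpi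
    right
    suffices h : ∀ k < i, p ∈ ε k → ∃ y, ε k = s(p, y) ∧ T.Adj p y ∧ T.dist r y < T.dist r p by
      intro k hk k' hk' hpk hpk'
      obtain ⟨y, hy, hpy, hdy⟩ := h k hk hpk
      obtain ⟨y', hy', hpy', hdy'⟩ := h k' hk' hpk'
      have := hT.eq_of_adj_of_dist_lt hpy hpy' hdy hdy'
      exact hε.injective (by rw [hy, hy', this])
    intro k hk hpk
    obtain ⟨y, hy, hpy⟩ := SimpleGraph.exists_mem_adj_of_mem_edgeSet (hmem k) hpk
    refine ⟨y, hy, hpy, ?_⟩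
    by_contra hdy
    have hdy' : T.dist r y = T.dist r p + 1 := by
      have := hT.dist_eq_dist_add_one_of_adj r hpy
      omega
    -- Edge `i` lies between two edges below `p`, so it has their level and upper end `p`.
    obtain ⟨p₁, c₁, hi, hpc₁, hd₁⟩ := hrep i
    have hlk : edgeLevel T r (ε k) = T.dist r p + 1 := by rw [hy, edgeLevel_of_dist hdy', hdy']
    have hli : edgeLevel T r (ε i) = T.dist r p₁ + 1 := by rw [hi, edgeLevel_of_dist hd₁, hd₁]
    have h1 := hε.level_mono k i hk.le
    have h2 := hε.level_mono i j hij.le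
    have hpp : T.dist r p₁ = T.dist r p := by omega
    have hne : p ≠ p₁ := by rintro rfl; exact hpi (by simp [hi])
    have hpr : p ≠ r := by
      rintro rfl
      rw [SimpleGraph.dist_self] at hpp
      exact hne (hT.connected.dist_eq_zero_iff.1 hpp)
    have hpr₁ : p₁ ≠ r := by
      rintro rfl
      rw [SimpleGraph.dist_self] at hpp
      exact hne (hT.connected.dist_eq_zero_iff.1 hpp.symm).symm
    obtain ⟨l, z, hl, hpz, hz⟩ := hparent p hpr
    obtain ⟨l₁, z₁, hl₁, hpz₁, hz₁⟩ := hparent p₁ hpr₁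
    have hll : edgeLevel T r (ε l) = T.dist r p := by rw [hl, edgeLevel_of_dist hz.symm]
    have hll₁ : edgeLevel T r (ε l₁) = T.dist r p₁ := by rw [hl₁, edgeLevel_of_dist hz₁.symm]
    have h3 : l ≤ l₁ := hε.leftToRight k i l l₁ (by omega) (by omega) (by omega)
      ⟨p, hpk, by simp [hl]⟩ ⟨p₁, by simp [hi], by simp [hl₁]⟩ hk
    have h4 : l₁ ≤ l := hε.leftToRight i j l₁ l (by omega) (by omega) (by omega)
      ⟨p₁, by simp [hi], by simp [hl₁]⟩ ⟨p, by simp [hj], by simp [hl]⟩ hij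
    have h5 : s(z, p) = s(z₁, p₁) := by rw [← hl, ← hl₁, le_antisymm h3 h4]
    rcases Sym2.eq_iff.1 h5 with ⟨-, h⟩ | ⟨h, -⟩
    · exact hne h
    · subst h; omega

/-- The edge closing the cycle may follow a level order whose last edge ends in `u`: before that
edge `u` is isolated, and the pendant vertex `v` is always on at most one edge. -/
lemma IsLevelOrder.exists_isFreeEnd_snoc (hT : T.IsTree) {ε : Fin (m + 1) → Sym2 (Fin n)}
    (hε : IsLevelOrder T r ε) {u v : Fin n} (hu : ∃! w, T.Adj u w) (hv : ∃! w, T.Adj v w)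
    (hlast : u ∈ ε (Fin.last m)) {i j : Fin (m + 2)} (hij : i < j) :
    ∃ p c, (Fin.snoc ε s(u, v) : Fin (m + 2) → Sym2 (Fin n)) j = s(p, c) ∧
      IsFreeEnd (Fin.snoc ε s(u, v) : Fin (m + 2) → Sym2 (Fin n)) i p c := by
  have hmem : ∀ k, ε k ∈ T.edgeSet := fun k => hε.range_eq ▸ Set.mem_range_self k
  have huniq : ∀ {w : Fin n}, (∃! x, T.Adj w x) → ∀ k k', w ∈ ε k → w ∈ ε k' → k = k' := by
    intro w hw k k' hk hk'
    obtain ⟨x, hx, hwx⟩ := SimpleGraph.exists_mem_adj_of_mem_edgeSet (hmem k) hk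
    obtain ⟨y, hy, hwy⟩ := SimpleGraph.exists_mem_adj_of_mem_edgeSet (hmem k') hk'
    exact hε.injective (by rw [hx, hy, hw.unique hwx hwy])
  obtain ⟨i, rfl⟩ : ∃ i', i = Fin.castSucc i' := ⟨i.castPred (Fin.ne_last_of_lt hij), by simp⟩
  have hlt : ∀ k < Fin.castSucc i, ∃ k' < i, k = Fin.castSucc k' := by
    intro k hk
    refine ⟨k.castPred (Fin.ne_last_of_lt (hk.trans hij)), ?_, by simp⟩
    rw [Fin.lt_def] at hk ⊢
    simpa using hk
  cases j using Fin.lastCases with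
  | last =>
    refine ⟨v, u, by rw [Fin.snoc_last, Sym2.eq_swap], fun k hk hku => ?_,
      Or.inr fun k hk k' hk' hv₁ hv₂ => ?_⟩
    · obtain ⟨k, hki, rfl⟩ := hlt k hk
      rw [Fin.snoc_castSucc] at hku
      have := huniq hu _ _ hku hlast
      exact absurd (Fin.le_last i) (not_le.2 (this ▸ hki))
    · obtain ⟨k, hki, rfl⟩ := hlt k hk
      obtain ⟨k', hki', rfl⟩ := hlt k' hk'
      rw [Fin.snoc_castSucc] at hv₁ hv₂
      rw [huniq hv _ _ hv₁ hv₂]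
  | cast j =>
    obtain ⟨p, c, hj, hc, hp⟩ := hε.exists_isFreeEnd hT (Fin.castSucc_lt_castSucc_iff.1 hij)
    refine ⟨p, c, by rw [Fin.snoc_castSucc, hj], fun k hk => ?_, ?_⟩
    · obtain ⟨k, hki, rfl⟩ := hlt k hk
      rw [Fin.snoc_castSucc]
      exact hc k hki
    · rw [Fin.snoc_castSucc]
      refine hp.imp_right fun hp k hk k' hk' h₁ h₂ => ?_
      obtain ⟨k, hki, rfl⟩ := hlt k hk
      obtain ⟨k', hki', rfl⟩ := hlt k' hk'
      rw [Fin.snoc_castSucc] at h₁ h₂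
      rw [hp k hki k' hki' h₁ h₂]

theorem isPSequence_snoc_levelOrder (K : Type*) [Field K] (hT : T.IsTree)
    {ε : Fin (m + 1) → Sym2 (Fin n)} (hε : IsLevelOrder T r ε) {u v : Fin n} (huv : u ≠ v)
    (hadj : ¬ T.Adj u v) (hu : ∃! w, T.Adj u w) (hv : ∃! w, T.Adj v w)
    (hlast : u ∈ ε (Fin.last m)) :
    IsPSequence (fun k : Fin (m + 2) =>
      edgeBinomial K ((Fin.snoc ε s(u, v) : Fin (m + 2) → Sym2 (Fin n)) k)) := by
  have hmem : ∀ k, ε k ∈ T.edgeSet := fun k => hε.range_eq ▸ Set.mem_range_self k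
  refine isPSequence_of_isFreeEnd ?_ ?_
    fun i j hij => hε.exists_isFreeEnd_snoc hT hu hv hlast hij
  · rw [Fin.snoc_injective_iff]
    refine ⟨hε.injective, ?_⟩
    rintro ⟨k, hk⟩
    exact hadj (by simpa [hk] using hmem k)
  · intro k
    cases k using Fin.lastCases with
    | last => simpa using huv
    | cast k =>
      rw [Fin.snoc_castSucc]
      exact T.not_isDiag_of_mem_edgeSet (hmem k)

end LevelOrder

/-! ### An order of the edges of the unicyclic graph -/

section Ranking

variable {n N : ℕ}

/-- The edges of a graph can be listed by the smaller of the ranks of their endpoints. -/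
lemma exists_edge_listing (G : SimpleGraph (Fin n)) (hN : G.edgeSet.ncard = N) {ρ : Fin n → ℕ}
    (hρ : Function.Injective ρ) :
    ∃ lo hi : Fin N → Fin n, Function.Injective (fun k => s(lo k, hi k)) ∧
      Set.range (fun k => s(lo k, hi k)) = G.edgeSet ∧ (∀ k, ρ (lo k) < ρ (hi k)) ∧
      ∀ i j, i ≤ j → ρ (lo i) ≤ ρ (lo j) := by
  classical
  have hrep : ∀ e : G.edgeSet, ∃ x y : Fin n, (e : Sym2 (Fin n)) = s(x, y) ∧ ρ x < ρ y := by
    rintro ⟨e, he⟩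
    induction e with
    | _ x y =>
    have hne : ρ x ≠ ρ y := fun h => G.ne_of_adj he (hρ h)
    rcases hne.lt_or_gt with h | h
    · exact ⟨x, y, rfl, h⟩
    · exact ⟨y, x, Sym2.eq_swap, h⟩
  choose f g hfg hlt using hrep
  have e : Fin N ≃ G.edgeSet := (finCongr hN.symm).trans (Finite.equivFin G.edgeSet).symm
  set σ := Tuple.sort fun k => ρ (f (e k))
  have hε : (fun k => s(f (e (σ k)), g (e (σ k)))) = fun k => ((e (σ k) : G.edgeSet) : Sym2 _) := by
    funext k
    exact (hfg _).symm
  refine ⟨fun k => f (e (σ k)), fun k => g (e (σ k)), ?_, ?_, fun k => hlt _,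
    fun i j hij => Tuple.monotone_sort (fun k => ρ (f (e k))) hij⟩
  · rw [hε]
    exact Subtype.val_injective.comp (e.injective.comp σ.injective)
  · rw [hε]
    have : (fun k => ((e (σ k) : G.edgeSet) : Sym2 (Fin n))) =
        Subtype.val ∘ ((σ.trans e : Fin N ≃ G.edgeSet) : Fin N → G.edgeSet) := rfl
    rw [this, (σ.trans e).surjective.range_comp, Subtype.range_coe]

/-- A ranking of the vertices of a unicyclic graph in which `q` is the only vertex with two
neighbours `a`, `v` of smaller rank, and `u`, `v`, `q` are consecutive vertices of the cycle and
of the ranking. -/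
structure IsUnicyclicRanking (G : SimpleGraph (Fin n)) (ρ : Fin n → ℕ) (a u v q : Fin n) :
    Prop where
  injective : Function.Injective ρ
  unique_lower : ∀ w y y', w ≠ q → G.Adj w y → G.Adj w y' → ρ y < ρ w → ρ y' < ρ w → y = y'
  lower_q : ∀ y, G.Adj q y → ρ y < ρ q → y = a ∨ y = v
  a_lt_v : ρ a < ρ v
  u_lt_v : ρ u < ρ v
  v_lt_q : ρ v < ρ q
  adj_u_v : G.Adj u v
  consecutive : ∀ w, ρ w ≤ ρ u ∨ w = v ∨ ρ q ≤ ρ w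
  upper_v : ∀ y, G.Adj v y → ρ v < ρ y → y = q
  upper_u : ∀ y, G.Adj u y → ρ u < ρ y → y = v ∨ (y = q ∧ u = a)

/-- In the listing of the edges by the smaller rank, the endpoint `hi j` of larger rank is new
when edge `j` appears, and the edges above `lo j` are consecutive. The exception is the edge
`{v, q}`, whose endpoint `q` already carries the edge `{a, q}`; its new endpoint is `v` (or `q`
itself, in a triangle). -/
lemma IsUnicyclicRanking.exists_isFreeEnd {G : SimpleGraph (Fin n)} {ρ : Fin n → ℕ}
    {a u v q : Fin n} (h : IsUnicyclicRanking G ρ a u v q) {lo hi : Fin N → Fin n}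
    (hinj : Function.Injective (fun k => s(lo k, hi k))) (hadj : ∀ k, G.Adj (lo k) (hi k))
    (hlt : ∀ k, ρ (lo k) < ρ (hi k)) (hmono : ∀ i j, i ≤ j → ρ (lo i) ≤ ρ (lo j))
    {i j : Fin N} (hij : i < j) :
    ∃ p c, s(lo j, hi j) = s(p, c) ∧ IsFreeEnd (fun k => s(lo k, hi k)) i p c := by
  have heq : ∀ k k', lo k = lo k' → hi k = hi k' → k = k' := fun k k' h₁ h₂ =>
    hinj (by simp only [h₁, h₂])
  have hmi : ∀ k < i, ρ (lo k) ≤ ρ (lo i) := fun k hk => hmono k i hk.le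
  have hmj := hmono i j hij.le
  have hul := h.unique_lower
  have hq := h.lower_q
  have hav := h.a_lt_v
  have huv := h.u_lt_v
  have hvq := h.v_lt_q
  have hadj' : ∀ k, G.Adj (hi k) (lo k) := fun k => (hadj k).symm
  have hv_up : ∀ k, lo k = v → hi k = q := fun k hk =>
    h.upper_v _ (hk ▸ hadj k) (hk ▸ hlt k)
  have hq_low : ∀ k, hi k = q → lo k = a ∨ lo k = v := fun k hk =>
    hq _ (hk ▸ hadj' k) (hk ▸ hlt k)
  have hlow : ∀ k k', hi k = hi k' → hi k ≠ q → k = k' := fun k k' hk hkq =>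
    heq k k' (hul _ _ _ hkq (hadj' k) (hk ▸ hadj' k') (hlt k) (hk ▸ hlt k')) hk
  have hv_low : ∀ k, hi k = v → lo k = u := fun k hk =>
    hul v _ _ (by rintro rfl; omega) (hk ▸ hadj' k) h.adj_u_v.symm (hk ▸ hlt k) huv
  have hne_lt : ∀ k k', ρ (lo k) < ρ k' → lo k ≠ k' := by
    rintro k _ hk rfl; omega
  by_cases hB : lo j = v
  · -- The edge `{v, q}`, which closes the cycle.
    have hjq := hv_up j hB
    have hvj : ∀ k < j, lo k ≠ v := fun k hk hkv => by
      have := heq k j (hkv.trans hB.symm) ((hv_up k hkv).trans hjq.symm)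
      omega
    have hq_lo : ∀ k < i, lo k ≠ q := fun k hk hkq => by
      have := hmi k hk
      rw [hkq] at this
      rw [hB] at hmj
      omega
    have hq_hi : ∀ k < i, hi k = q → lo k = a := fun k hk hkq =>
      (hq_low k hkq).resolve_right (hvj k (hk.trans hij))
    by_cases hC : ∀ k < i, v ∉ s(lo k, hi k)
    · refine ⟨q, v, by rw [hB, hjq, Sym2.eq_swap], hC, Or.inr fun k hk k' hk' h₁ h₂ => ?_⟩
      have e₁ : hi k = q := ((Sym2.mem_iff.1 h₁).resolve_left (hq_lo k hk).symm).symm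
      have e₂ : hi k' = q := ((Sym2.mem_iff.1 h₂).resolve_left (hq_lo k' hk').symm).symm
      exact heq k k' ((hq_hi k hk e₁).trans (hq_hi k' hk' e₂).symm) (e₁.trans e₂.symm)
    · -- The edge `{u, v}` occurs before edge `i`; this happens only in a triangle, where
      -- edge `i` is `{u, q}`.
      push Not at hC
      obtain ⟨k, hk, hkv⟩ := hC
      have hv_hi : ∀ k < i, v ∈ s(lo k, hi k) → hi k = v := fun k hk hkv =>
        ((Sym2.mem_iff.1 hkv).resolve_left (hvj k (hk.trans hij)).symm).symm
      have hk₁ := hv_hi k hk hkv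
      have hk₂ := hv_low k hk₁
      have hiu : lo i = u := by
        have h₁ := hmi k hk
        rw [hk₂] at h₁
        rcases h.consecutive (lo i) with h' | h' | h'
        · exact h.injective (by omega)
        · exact absurd h' (hvj i hij)
        · rw [hB] at hmj; omega
      obtain ⟨hiq, hua⟩ : hi i = q ∧ u = a := by
        refine (h.upper_u _ (hiu ▸ hadj i) (hiu ▸ hlt i)).resolve_left fun hiv => ?_
        have := heq k i (hk₂.trans hiu.symm) (hk₁.trans hiv.symm)
        omega
      refine ⟨v, q, by rw [hB, hjq], fun k' hk' hkq => ?_, Or.inr fun k₁ hk₁ k₂ hk₂ h₁ h₂ => ?_⟩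
      · have e₁ : hi k' = q := ((Sym2.mem_iff.1 hkq).resolve_left (hq_lo k' hk').symm).symm
        have := heq k' i ((hq_hi k' hk' e₁).trans (hua.symm.trans hiu.symm)) (e₁.trans hiq.symm)
        omega
      · exact hlow k₁ k₂ ((hv_hi k₁ hk₁ h₁).trans (hv_hi k₂ hk₂ h₂).symm)
          (by rw [hv_hi k₁ hk₁ h₁]; rintro rfl; omega)
  · refine ⟨lo j, hi j, rfl, fun k hk hck => ?_, ?_⟩
    · have hkj := (hmi k hk).trans hmj
      have e₁ : hi k = hi j := by
        refine ((Sym2.mem_iff.1 hck).resolve_left fun h' => ?_).symm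
        have := hlt j
        rw [h'] at this
        omega
      by_cases hjq : hi j = q
      · have hja := (hq_low j hjq).resolve_right hB
        have hka : lo k = a := (hq_low k (e₁.trans hjq)).resolve_right fun h' => by
          rw [h', hja] at hkj
          omega
        have := heq k j (hka.trans hja.symm) e₁
        omega
      · have := hlow k j e₁ (e₁ ▸ hjq)
        omega
    · by_cases hij' : lo i = lo j
      · exact Or.inl (by simp [hij'])
      right
      have hlt' : ρ (lo i) < ρ (lo j) :=
        lt_of_le_of_ne hmj fun h' => hij' (h.injective h')
      have hhi : ∀ k < i, lo j ∈ s(lo k, hi k) → hi k = lo j := fun k hk hkj =>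
        ((Sym2.mem_iff.1 hkj).resolve_left
          (hne_lt k _ (lt_of_le_of_lt (hmi k hk) hlt')).symm).symm
      intro k hk k' hk' h₁ h₂
      have e₁ := hhi k hk h₁
      have e₂ := hhi k' hk' h₂
      by_cases hjq : lo j = q
      · -- The edge `{v, q}` is not before `i`: the edges listed after it have both ranks at
        -- least `ρ q`, whereas `ρ (lo i) < ρ q`.
        have ha : ∀ k < i, hi k = q → lo k = a := fun k hk hkq =>
          (hq_low k hkq).resolve_right fun hkv => by
            have h₁ := hmi k hk
            rw [hkv] at h₁
            rw [hjq] at hlt'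
            rcases h.consecutive (lo i) with h' | h' | h'
            · omega
            · have := heq k i (hkv.trans h'.symm) (hkq.trans (hv_up i h').symm)
              omega
            · omega
        exact heq k k' ((ha k hk (e₁.trans hjq)).trans (ha k' hk' (e₂.trans hjq)).symm)
          (e₁.trans e₂.symm)
      · exact hlow k k' (e₁.trans e₂.symm) (e₁ ▸ hjq)

/-- The ranking puts first the component of `a` in the tree without the edge `{q, a}`, by distance
from `a` but with `u` at the end, then `v` and `q`, then all other vertices by distance
from `q`. -/
lemma exists_isUnicyclicRanking {T : SimpleGraph (Fin n)} (hT : T.IsTree) {u v : Fin n}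
    (huv : u ≠ v) (hadj : ¬ T.Adj u v) (hu : ∃! w, T.Adj u w) (hv : ∃! w, T.Adj v w) :
    ∃ ρ a q, IsUnicyclicRanking (T ⊔ SimpleGraph.edge u v) ρ a u v q := by
  classical
  obtain ⟨q, hvq, hq_uniq⟩ := hv
  have huq : u ≠ q := by rintro rfl; exact hadj hvq.symm
  have hvq_ne : v ≠ q := hvq.ne
  -- `a` is the neighbour of `q` towards `u`.
  obtain ⟨a, hqa, ha⟩ := hT.connected.exists_adj_dist_add_one (r := u) huq.symm
  have hGadj : ∀ x y, (T ⊔ SimpleGraph.edge u v).Adj x y ↔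
      T.Adj x y ∨ (x = u ∧ y = v) ∨ (x = v ∧ y = u) := by
    intro x y
    rw [SimpleGraph.sup_adj, SimpleGraph.edge_adj]
    constructor
    · rintro (h | ⟨h, -⟩)
      · exact Or.inl h
      · exact Or.inr h
    · rintro (h | ⟨rfl, rfl⟩ | ⟨rfl, rfl⟩)
      · exact Or.inl h
      · exact Or.inr ⟨Or.inl ⟨rfl, rfl⟩, huv⟩
      · exact Or.inr ⟨Or.inr ⟨rfl, rfl⟩, huv.symm⟩
  -- The component of `a` in the tree without the edge `{q, a}`.
  let D : Fin n → Prop := fun w => T.dist a w < T.dist q w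
  have hDu : D u := by
    simp only [D]
    rw [SimpleGraph.dist_comm, SimpleGraph.dist_comm (u := q)]
    omega
  have hDq : ¬ D q := by simp [D]
  have hDa : D a := by
    simp only [D, SimpleGraph.dist_self]
    exact hT.connected.pos_dist_of_ne hqa.ne
  have hcross : ∀ x y, T.Adj x y → D x → ¬ D y → x = a ∧ y = q := fun x y hxy hx hy =>
    hT.eq_and_eq_of_dist_lt hqa hxy hx hy
  have hav : a ≠ v := by
    rintro rfl
    -- Otherwise the only neighbour `q` of `a` is closer to `u` than `a`.
    have hau : a ≠ u := huv.symm
    obtain ⟨y, hy, hyu⟩ := hT.connected.exists_adj_dist_add_one (r := u) hau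
    have := hq_uniq y hy
    subst this
    omega
  have hDv : ¬ D v := fun h => hav (hcross v q hvq h hDq).1.symm
  have hdist : ∀ x y, T.dist x y < n := by
    intro x y
    obtain ⟨p, hp, hpl⟩ := hT.connected.exists_path_of_dist x y
    have := hp.length_lt
    simpa [hpl] using this
  let h : Fin n → ℕ := fun w =>
    if w = u then n else if w = v then n + 1 else if w = q then n + 2 else
      if D w then T.dist a w else n + 3 + T.dist q w
  have hhu : h u = n := by simp [h]
  have hhv : h v = n + 1 := by simp [h, huv.symm]
  have hhq : h q = n + 2 := by simp [h, huq.symm, hvq_ne.symm]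
  have hhD : ∀ w, D w → w ≠ u → h w = T.dist a w := by
    intro w hw hwu
    have h1 : w ≠ v := by rintro rfl; exact hDv hw
    have h2 : w ≠ q := by rintro rfl; exact hDq hw
    simp [h, hwu, h1, h2, hw]
  have hhR : ∀ w, ¬ D w → w ≠ v → w ≠ q → h w = n + 3 + T.dist q w := by
    intro w hw hwv hwq
    have h1 : w ≠ u := by rintro rfl; exact hw hDu
    simp [h, hwv, h1, hwq, hw]
  -- Ties are broken by the numbering of the vertices.
  let ρ : Fin n → ℕ := fun w => h w * n + w
  have hlt : ∀ x y, h x < h y → ρ x < ρ y := by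
    intro x y hxy
    have h1 : (h x + 1) * n ≤ h y * n := Nat.mul_le_mul_right n hxy
    have h2 := x.isLt
    simp only [ρ]
    rw [add_mul] at h1
    omega
  have hle : ∀ x y, ρ x < ρ y → h x ≤ h y := fun x y hxy => by
    by_contra hc
    have := hlt y x (not_le.1 hc)
    omega
  have hρ : Function.Injective ρ := by
    intro x y hxy
    have hh : h x = h y := by
      by_contra hne
      rcases Nat.lt_or_gt_of_ne hne with hc | hc
      · have := hlt _ _ hc; omega
      · have := hlt _ _ hc; omega
    simp only [ρ, hh] at hxy
    exact Fin.ext (by omega)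
  have hu' : ∀ y y', T.Adj u y → T.Adj u y' → y = y' := fun y y' h₁ h₂ => hu.unique h₁ h₂
  refine ⟨ρ, a, q, hρ, ?_, ?_, ?_, hlt _ _ (by omega), hlt _ _ (by omega),
    (hGadj _ _).2 (Or.inr (Or.inl ⟨rfl, rfl⟩)), ?_, ?_, ?_⟩
  · intro w y y' hwq hy hy' hyw hyw'
    by_cases hwu : w = u
    · subst hwu
      have key : ∀ y, (T ⊔ SimpleGraph.edge w v).Adj w y → ρ y < ρ w → T.Adj w y := by
        intro y hy hyw
        rcases (hGadj _ _).1 hy with h' | ⟨-, rfl⟩ | ⟨h', -⟩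
        · exact h'
        · have := hle _ _ hyw; omega
        · exact absurd h' huv
      exact hu' y y' (key y hy hyw) (key y' hy' hyw')
    by_cases hwv : w = v
    · subst hwv
      have key : ∀ y, (T ⊔ SimpleGraph.edge u w).Adj w y → ρ y < ρ w → y = u := by
        intro y hy hyw
        rcases (hGadj _ _).1 hy with h' | ⟨h', -⟩ | ⟨-, rfl⟩
        · have := hq_uniq y h'
          subst this
          have := hle _ _ hyw
          omega
        · exact absurd h'.symm huv
        · rfl
      rw [key y hy hyw, key y' hy' hyw']
    have hTadj : ∀ y, (T ⊔ SimpleGraph.edge u v).Adj w y → T.Adj w y := fun y hy =>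
      ((hGadj _ _).1 hy).resolve_right (by rintro (⟨h', -⟩ | ⟨h', -⟩); exacts [hwu h', hwv h'])
    by_cases hDw : D w
    · have hw := hhD w hDw hwu
      have hwn := hdist a w
      have key : ∀ y, T.Adj w y → ρ y < ρ w → T.dist a y < T.dist a w := by
        intro y hy hyw
        have hyw' := hle _ _ hyw
        have hyD : D y := by
          by_contra hyD
          have := (hcross w y hy hDw hyD).2
          subst this
          omega
        have hyu : y ≠ u := by rintro rfl; omega
        rw [hw, hhD y hyD hyu] at hyw'
        exact lt_of_le_of_ne hyw' (hT.dist_ne_of_adj a hy).symm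
      exact hT.eq_of_adj_of_dist_lt (hTadj y hy) (hTadj y' hy') (key y (hTadj y hy) hyw)
        (key y' (hTadj y' hy') hyw')
    · have hw := hhR w hDw hwv hwq
      have key : ∀ y, T.Adj w y → ρ y < ρ w → T.dist q y < T.dist q w := by
        intro y hTy hyw
        have hyw' := hle _ _ hyw
        by_cases hyD : D y
        · exact absurd (hcross y w hTy.symm hyD hDw).2 hwq
        by_cases hyq : y = q
        · subst hyq
          rw [SimpleGraph.dist_self]
          exact hT.connected.pos_dist_of_ne hTy.ne.symm
        have hyv : y ≠ v := by rintro rfl; exact hwq (hq_uniq w hTy.symm)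
        rw [hw, hhR y hyD hyv hyq] at hyw'
        exact lt_of_le_of_ne (by omega) (hT.dist_ne_of_adj q hTy).symm
      exact hT.eq_of_adj_of_dist_lt (hTadj y hy) (hTadj y' hy') (key y (hTadj y hy) hyw)
        (key y' (hTadj y' hy') hyw')
  · intro y hy hyq
    have hyq' := hle _ _ hyq
    have hTy : T.Adj q y := ((hGadj _ _).1 hy).resolve_right
      (by rintro (⟨h', -⟩ | ⟨h', -⟩); exacts [huq h'.symm, hvq_ne h'.symm])
    by_cases hyv : y = v
    · exact Or.inr hyv
    left
    have hyD : D y := by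
      by_contra hyD
      have := hhR y hyD hyv hTy.ne.symm
      omega
    exact (hcross y q hTy.symm hyD hDq).1
  · apply hlt
    by_cases hau : a = u
    · rw [hau]; omega
    · rw [hhD a hDa hau, hhv, SimpleGraph.dist_self]; omega
  · intro w
    by_cases hwu : w = u
    · left; rw [hwu]
    by_cases hwv : w = v
    · exact Or.inr (Or.inl hwv)
    by_cases hwq : w = q
    · right; right; rw [hwq]
    by_cases hDw : D w
    · left
      have := hdist a w
      exact (hlt _ _ (by rw [hhD w hDw hwu]; omega)).le
    · right; right
      exact (hlt _ _ (by rw [hhR w hDw hwv hwq]; omega)).le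
  · intro y hy hvy
    rcases (hGadj _ _).1 hy with h' | ⟨h', -⟩ | ⟨-, rfl⟩
    · exact hq_uniq y h'
    · exact absurd h'.symm huv
    · have := hle _ _ hvy
      omega
  · intro y hy huy
    rcases (hGadj _ _).1 hy with h' | ⟨-, h'⟩ | ⟨h', -⟩
    · right
      by_cases hyD : D y
      · have hyu : y ≠ u := h'.ne.symm
        have := hle _ _ huy
        rw [hhu, hhD y hyD hyu] at this
        have := hdist a y
        omega
      · exact ⟨(hcross u y h' hDu hyD).2, (hcross u y h' hDu hyD).1⟩
    · exact Or.inl h'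
    · exact absurd h' huv

end Ranking

theorem mainTheorem3 (K : Type*) [Field K] {n : ℕ} (T : SimpleGraph (Fin n)) [DecidableRel T.Adj]
    (hT : T.IsTree) (u v : Fin n) (huv : u ≠ v) (hadj : ¬ T.Adj u v)
    (hu : T.degree u = 1) (hv : T.degree v = 1) :
    (∃ ε : Fin n → Sym2 (Fin n), Function.Injective ε ∧
      Set.range ε = (T ⊔ SimpleGraph.edge u v).edgeSet ∧
      IsPSequence (fun k => edgeBinomial K (ε k))) ∧
    (∀ (r : Fin n), T.degree r = 1 →
      ∀ (m : ℕ) (ε : Fin (m + 1) → Sym2 (Fin n)), IsLevelOrder T r ε →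
        (u ∈ ε (Fin.last m) ∨ v ∈ ε (Fin.last m)) →
        IsPSequence (fun k : Fin (m + 2) =>
          edgeBinomial K ((Fin.snoc ε s(u, v) : Fin (m + 2) → Sym2 (Fin n)) k))) := by
  classical
  have hu' := SimpleGraph.degree_eq_one_iff_existsUnique_adj.1 hu
  have hv' := SimpleGraph.degree_eq_one_iff_existsUnique_adj.1 hv
  constructor
  · obtain ⟨ρ, a, q, hρ⟩ := exists_isUnicyclicRanking hT huv hadj hu' hv'
    have hcard : (T ⊔ SimpleGraph.edge u v).edgeSet.ncard = n := by
      rw [← SimpleGraph.coe_edgeFinset, Set.ncard_coe_finset,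
        SimpleGraph.card_edgeFinset_sup_edge T hadj huv, hT.card_edgeFinset, Fintype.card_fin]
    obtain ⟨lo, hi, hinj, hrange, hlt, hmono⟩ :=
      exists_edge_listing (T ⊔ SimpleGraph.edge u v) hcard hρ.injective
    have hmem : ∀ k, s(lo k, hi k) ∈ (T ⊔ SimpleGraph.edge u v).edgeSet := fun k =>
      hrange ▸ Set.mem_range_self k
    exact ⟨fun k => s(lo k, hi k), hinj, hrange, isPSequence_of_isFreeEnd hinj
      (fun k => SimpleGraph.not_isDiag_of_mem_edgeSet _ (hmem k))
      fun i j hij => hρ.exists_isFreeEnd hinj hmem hlt hmono hij⟩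
  · rintro r - m ε hε (h | h)
    · exact isPSequence_snoc_levelOrder K hT hε huv hadj hu' hv' h
    · rw [Sym2.eq_swap]
      exact isPSequence_snoc_levelOrder K hT hε huv.symm (fun h => hadj h.symm) hv' hu' h
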